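/- Let $\theta=(1+\sqrt{-7})/2\in\mathbb{C}$, let $\mathbb{Z}[\theta]$ be the subring of $\mathbb{C}$ generated by $\theta$, and consider the $\mathbb{Z}[\theta]$-algebra $$D=\mathbb{Z}[\theta][X,Y]/\bigl((1-\theta)X^2+\theta XY+(1-\theta)Y^2-1\bigr).$$ Then $D$ is a regular ring (that is, it is Noetherian and its localization at every prime ideal is a regular local ring), and $D$ is not smooth over $\mathbb{Z}[\theta]$. Moreover, put $a=c=1-\theta$, $b=\theta$, $d=e=1$ and $P=\theta\mathbb{Z}[\theta]$. Then $P$ is the only prime ideal of $\mathbb{Z}[\theta]$ that contains $(2,b)$ but does not contain $(a,c)$, and it satisfies: $a\notin P$, $d^2\equiv a$ and $e^2\equiv c \pmod P$, $b-2de\in P^2$, $cd^2-ae^2\in P^2$, and $a-d^2\notin P^2$. -/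

import Mathlib

namespace ConicExample

/-- The complex number `θ = (1 + √-7) / 2`. -/
noncomputable def theta : ℂ := (1 + (Real.sqrt 7 : ℂ) * Complex.I) / 2

/-- The ring `ℤ[θ]`, the smallest subring of `ℂ` containing `θ`. -/
noncomputable abbrev ZTheta : Subalgebra ℤ ℂ := Algebra.adjoin ℤ {theta}

/-- The element `θ` of the ring `ℤ[θ]`. -/
noncomputable def th : ZTheta := ⟨theta, Algebra.self_mem_adjoin_singleton ℤ theta⟩

/-- The polynomial `aX² + bXY + cY² - 1` in `B[X, Y]`, with `X = X 0` and `Y = X 1`. -/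
noncomputable def conicPoly {B : Type*} [CommRing B] (a b c : B) : MvPolynomial (Fin 2) B :=
  MvPolynomial.C a * MvPolynomial.X 0 ^ 2
    + MvPolynomial.C b * MvPolynomial.X 0 * MvPolynomial.X 1
    + MvPolynomial.C c * MvPolynomial.X 1 ^ 2 - 1

/-- The `B`-algebra `B[X, Y] / (aX² + bXY + cY² - 1)`. -/
abbrev ConicRing {B : Type*} [CommRing B] (a b c : B) : Type _ :=
  MvPolynomial (Fin 2) B ⧸ Ideal.span {conicPoly a b c}

/-- The set `Γ` of the prime ideals of `B` that contain `(2, b)` but not `(a, c)`. -/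
def Gam {B : Type*} [CommRing B] (a b c : B) : Set (Ideal B) :=
  {P | P.IsPrime ∧ Ideal.span {2, b} ≤ P ∧ ¬ Ideal.span {a, c} ≤ P}

/-- The regularity condition at a prime `P` with `a ∉ P`, where `d` and `e` are
square roots of `a` and `c` modulo `P`. -/
structure RegularAt {B : Type*} [CommRing B] (P : Ideal B) (a b c d e : B) : Prop where
  a_notMem : a ∉ P
  sq_d : d ^ 2 - a ∈ P
  sq_e : e ^ 2 - c ∈ P
  b_sub : b - 2 * d * e ∈ P ^ 2
  cd_sub : c * d ^ 2 - a * e ^ 2 ∈ P ^ 2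
  a_sub : a - d ^ 2 ∉ P ^ 2

end ConicExample

/-! Write f for the conic polynomial and A = ℤ[θ][X, Y]. ℤ[θ] is norm-Euclidean, so A is a regular
domain, and A/(f) is regular once f ∉ q²A_q for every prime q containing f. Otherwise both partials
of f lie in q, and Euler's relation puts 2 = θ(1 - θ) in q, which forces θ ∈ q. Modulo θ the conic
is the double line w² = 0 with w = X + Y + 1; exactly, f = w² + θg with g ≡ 1 mod (θ, w). Since θ ∉
q²A_q, this gives g ∈ q, a contradiction. Smoothness fails because the point (1, 0) modulo θ has no
lift modulo θ². -/

open IsLocalRing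

/-! ### Regular hypersurfaces and primes with two generators -/

/-- The quotient of a regular local domain by an element of `𝔪` outside `𝔪²` is regular. -/
theorem IsRegularLocalRing.quotient_span_singleton {R : Type*} [CommRing R] [IsDomain R]
    [IsRegularLocalRing R] {f : R} (hf : f ∈ maximalIdeal R) (hf2 : f ∉ maximalIdeal R ^ 2) :
    IsRegularLocalRing (R ⧸ Ideal.span {f}) := by
  classical
  have hf0 : f ≠ 0 := fun h => hf2 (h ▸ zero_mem _)
  have hne : Ideal.span {f} ≠ ⊤ := fun h =>
    (maximalIdeal.isMaximal R).ne_top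
      (top_le_iff.mp (h ▸ (Ideal.span_singleton_le_iff_mem _).mpr hf))
  have : Nontrivial (R ⧸ Ideal.span {f}) := Ideal.Quotient.nontrivial_iff.mpr hne
  have : IsLocalRing (R ⧸ Ideal.span {f}) :=
    IsLocalRing.of_surjective' (Ideal.Quotient.mk _) Ideal.Quotient.mk_surjective
  apply IsRegularLocalRing.of_spanFinrank_maximalIdeal_le
  have hdim := ringKrullDim_quotient_span_singleton_succ_eq_ringKrullDim_of_mem_nonZeroDivisors
    (mem_nonZeroDivisors_of_ne_zero hf0) hf
  obtain ⟨s, hcard, hspan⟩ :=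
    Submodule.FG.exists_span_finset_card_eq_spanFinrank (maximalIdeal R).fg_of_isNoetherianRing
  have hs_mem : ∀ x ∈ s, x ∈ maximalIdeal R := fun x hx => hspan ▸ Submodule.subset_span hx
  obtain ⟨c, -, hc⟩ := Submodule.mem_span_finset.mp (hspan.symm ▸ hf)
  -- As `f ∉ 𝔪²`, some coefficient is a unit; modulo `f` that generator is redundant, matching the
  -- drop of the dimension by one.
  obtain ⟨x, hx, hcx⟩ : ∃ x ∈ s, IsUnit (c x) := by
    by_contra! h
    refine hf2 (hc ▸ Submodule.sum_mem _ fun x hx => ?_)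
    rw [pow_two]
    exact Ideal.mul_mem_mul ((mem_maximalIdeal _).mpr (h x hx)) (hs_mem x hx)
  let π := Ideal.Quotient.mk (Ideal.span {f})
  have hmax : maximalIdeal (R ⧸ Ideal.span {f}) =
      Ideal.span (((s.erase x).image π : Finset _) : Set (R ⧸ Ideal.span {f})) := by
    have hmap : (maximalIdeal R).map π = maximalIdeal (R ⧸ Ideal.span {f}) :=
      IsLocalRing.map_maximalIdeal_of_surjective π Ideal.Quotient.mk_surjective
    have hle : ∀ y ∈ s.erase x, π y ∈
        Ideal.span (((s.erase x).image π : Finset _) : Set (R ⧸ Ideal.span {f})) := fun y hy =>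
      Ideal.subset_span (Finset.mem_coe.mpr (Finset.mem_image_of_mem _ hy))
    apply le_antisymm
    · rw [← hmap, ← hspan]
      change Ideal.map π (Ideal.span (s : Set R)) ≤ _
      rw [Ideal.map_span, Ideal.span_le]
      rintro _ ⟨y, hy, rfl⟩
      by_cases hyx : y = x
      · subst hyx
        have h0 : π f = 0 := Ideal.Quotient.eq_zero_iff_mem.mpr (Ideal.mem_span_singleton_self f)
        have hc' : c y * y + ∑ z ∈ s.erase y, c z * z = f :=
          (Finset.add_sum_erase _ (fun z => c z * z) hx).trans hc
        rw [show π f = _ from congrArg π hc'.symm, map_add, map_sum, map_mul] at h0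
        rw [SetLike.mem_coe, ← Ideal.unit_mul_mem_iff_mem _ (hcx.map π), eq_neg_of_add_eq_zero_left h0]
        refine neg_mem (Submodule.sum_mem _ fun z hz => ?_)
        rw [map_mul]
        exact Ideal.mul_mem_left _ _ (hle z hz)
      · exact hle y (Finset.mem_erase.mpr ⟨hyx, hy⟩)
    · rw [Ideal.span_le, ← hmap]
      intro z hz
      obtain ⟨y, hy, rfl⟩ := Finset.mem_image.mp (Finset.mem_coe.mp hz)
      exact Ideal.mem_map_of_mem _ (hs_mem y (Finset.mem_of_mem_erase hy))
  have hle : (maximalIdeal (R ⧸ Ideal.span {f})).spanFinrank + 1 ≤ s.card := by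
    have h1 : (maximalIdeal (R ⧸ Ideal.span {f})).spanFinrank ≤ (s.erase x).card := by
      rw [hmax]
      refine (Submodule.spanFinrank_span_le_ncard_of_finite (Finset.finite_toSet _)).trans ?_
      rw [Set.ncard_coe_finset]
      exact Finset.card_image_le
    have := Finset.card_erase_add_one hx
    omega
  rw [hcard] at hle
  have hreg := (isRegularLocalRing_iff R).mp inferInstance
  rw [← hdim] at hreg
  have h2 : (((maximalIdeal (R ⧸ Ideal.span {f})).spanFinrank + 1 : ℕ) : WithBot ℕ∞) ≤
      ringKrullDim (R ⧸ Ideal.span {f}) + 1 := by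
    rw [← hreg]; exact_mod_cast hle
  rw [Nat.cast_add, Nat.cast_one] at h2
  exact ENat.WithBot.add_le_add_one_right_iff.mp h2

/-- A hypersurface `A ⧸ (f)` in a regular domain is regular when `f` lies in no `q ^ 2 A_q`. -/
theorem IsRegularRing.quotient_span_singleton {A : Type*} [CommRing A] [IsDomain A]
    [IsRegularRing A] (f : A)
    (hf : ∀ q : Ideal A, q.IsPrime → f ∈ q → ∀ s, s * f ∈ q ^ 2 → s ∈ q) :
    IsRegularRing (A ⧸ Ideal.span {f}) := by
  rw [isRegularRing_iff]
  intro p hp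
  let q : Ideal A := p.comap (Ideal.Quotient.mk (Ideal.span {f}))
  have hq : q.IsPrime := inferInstance
  have hfq : f ∈ q := by
    rw [Ideal.mem_comap, Ideal.Quotient.eq_zero_iff_mem.mpr (Ideal.mem_span_singleton_self f)]
    exact zero_mem _
  let S := Localization.AtPrime q
  have hm : maximalIdeal S = q.map (algebraMap A S) := (Localization.AtPrime.map_eq_maximalIdeal).symm
  have hreg : IsRegularLocalRing (S ⧸ Ideal.span {algebraMap A S f}) := by
    have : IsDomain S := IsLocalization.isDomain_localization q.primeCompl_le_nonZeroDivisors
    apply IsRegularLocalRing.quotient_span_singleton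
    · rw [hm]; exact Ideal.mem_map_of_mem _ hfq
    · rw [hm, ← Ideal.map_pow, IsLocalization.algebraMap_mem_map_algebraMap_iff q.primeCompl]
      rintro ⟨s, hs, hsf⟩
      exact hs (hf q hq hfq s hsf)
  have hI : (Ideal.span {f}).map (algebraMap A S) = Ideal.span {algebraMap A S f} := by
    rw [Ideal.map_span, Set.image_singleton]
  rw [← hI] at hreg
  have hlo : p.LiesOver q := ⟨rfl⟩
  have hsub : Algebra.algebraMapSubmonoid (A ⧸ Ideal.span {f}) q.primeCompl = p.primeCompl :=
    Ideal.algebraMapSubmonoid_primeCompl_of_liesOver_surjective p q Ideal.Quotient.mk_surjective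
  have hloc : IsLocalization p.primeCompl (S ⧸ (Ideal.span {f}).map (algebraMap A S)) := by
    rw [← hsub]; infer_instance
  exact IsRegularLocalRing.of_ringEquiv
    (IsLocalization.algEquiv p.primeCompl (S ⧸ (Ideal.span {f}).map (algebraMap A S))
      (Localization.AtPrime p)).toRingEquiv

/-- A prime `q` with two generators `t` and `h`, the first of them prime, has `t ∉ q ^ 2 A_q`. -/
theorem Ideal.mem_of_mul_mem_span_pair_sq {A : Type*} [CommRing A] [IsDomain A] {t h s : A}
    (ht : Prime t) (hs : s * t ∈ Ideal.span {t, h} ^ 2) : s ∈ Ideal.span {t, h} := by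
  obtain ⟨a, b, c, d, hs⟩ : ∃ a b c d, s * t = a * (t * t) + (b * (t * h) + (c * (h * t) + d * (h * h))) := by
    rw [pow_two, Ideal.span_pair_mul_span_pair] at hs
    obtain ⟨a, z, hz, hs⟩ := Ideal.mem_span_insert.mp hs
    obtain ⟨b, w, hw, hz⟩ := Ideal.mem_span_insert.mp hz
    obtain ⟨c, d, hw⟩ := Ideal.mem_span_pair.mp hw
    exact ⟨a, b, c, d, by rw [hs, hz, hw]⟩
  -- Cancelling `t` leaves `s` in `(t, h)` up to `d * h * h / t`, which the primality of `t` shows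
  -- to be a multiple of `h`.
  have key : ∀ k, d * h * h = t * k → s = (a * t + b * h + c * h) + k := by
    intro k hk
    have h0 : t * (s - ((a * t + b * h + c * h) + k)) = 0 := by linear_combination hs + hk
    exact sub_eq_zero.mp ((mul_eq_zero.mp h0).resolve_left ht.ne_zero)
  have hdvd : t ∣ d * h * h := ⟨s - a * t - b * h - c * h, by linear_combination -hs⟩
  rcases ht.dvd_or_dvd hdvd with ⟨k, hk⟩ | ⟨k, hk⟩
  · exact Ideal.mem_span_pair.mpr ⟨a, b + c + k, by
      linear_combination -key (k * h) (by linear_combination h * hk)⟩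
  · exact Ideal.mem_span_pair.mpr ⟨a, b + c + d * k, by
      linear_combination -key (d * h * k) (by linear_combination d * h * hk)⟩

/-- If `B ⧸ (t)` is a principal ideal ring, a prime of `B` containing `t` is `(t, h)` for some `h`. -/
theorem Ideal.exists_eq_span_pair {B C : Type*} [CommRing B] [CommRing C] [IsPrincipalIdealRing C]
    (φ : B →+* C) (hφ : Function.Surjective φ) {t : B} (hker : RingHom.ker φ = Ideal.span {t})
    {q : Ideal B} (htq : t ∈ q) : ∃ h, q = Ideal.span {t, h} := by
  obtain ⟨g, hg⟩ := IsPrincipalIdealRing.principal (q.map φ)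
  obtain ⟨h, rfl⟩ := hφ g
  refine ⟨h, ?_⟩
  have h1 := Ideal.comap_map_of_surjective' φ hφ q
  rw [hker, sup_eq_left.mpr ((Ideal.span_singleton_le_iff_mem _).mpr htq)] at h1
  rw [← h1, hg, ← Ideal.span, Ideal.span_insert, ← hker, sup_comm,
    ← Ideal.comap_map_of_surjective' φ hφ, Ideal.map_span, Set.image_singleton]
-- Arithmetic of ℤ[θ]
namespace ConicExample
open Complex

theorem theta_re : theta.re = 1 / 2 := by simp [theta]

theorem theta_im : theta.im = Real.sqrt 7 / 2 := by simp [theta]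

theorem theta_sq : theta ^ 2 = theta - 2 := by
  have h7 : ((Real.sqrt 7 : ℝ) : ℂ) ^ 2 = 7 := by
    rw [← Complex.ofReal_pow, Real.sq_sqrt (by norm_num)]; norm_num
  unfold theta
  linear_combination (1 / 4 : ℂ) * (I ^ 2) * h7 + (7 / 4 : ℂ) * I_sq

theorem th_sq : th ^ 2 = th - 2 := Subtype.ext theta_sq

theorem exists_eq_add_mul_th (z : ZTheta) : ∃ x y : ℤ, z = (x : ZTheta) + y * th := by
  obtain ⟨z, hz⟩ := z
  suffices ∃ x y : ℤ, z = (x : ℂ) + y * theta by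
    obtain ⟨x, y, h⟩ := this
    exact ⟨x, y, Subtype.ext (by simpa [th] using h)⟩
  induction hz using Algebra.adjoin_induction with
  | mem x hx => exact ⟨0, 1, by simpa using hx⟩
  | algebraMap r => exact ⟨r, 0, by simp⟩
  | add u v _ _ hu hv =>
    obtain ⟨x, y, rfl⟩ := hu
    obtain ⟨x', y', rfl⟩ := hv
    exact ⟨x + x', y + y', by push_cast; ring⟩
  | mul u v _ _ hu hv =>
    obtain ⟨x, y, rfl⟩ := hu
    obtain ⟨x', y', rfl⟩ := hv
    exact ⟨x * x' - 2 * y * y', x * y' + y * x' + y * y', by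
      push_cast; linear_combination (y * y' : ℂ) * theta_sq⟩

theorem add_mul_th_injective {x y x' y' : ℤ}
    (h : (x : ZTheta) + y * th = x' + y' * th) : x = x' ∧ y = y' := by
  have hC : (x : ℂ) + y * theta = x' + y' * theta := by
    simpa [th] using congrArg (Subtype.val) h
  have h7 : (0 : ℝ) < Real.sqrt 7 := by positivity
  have him := congrArg Complex.im hC
  simp only [add_im, intCast_im, mul_im, intCast_re, theta_im, zero_mul, add_zero, zero_add] at him
  have hy : y = y' := by
    exact_mod_cast mul_right_cancel₀ (by positivity) him
  subst hy
  exact ⟨by exact_mod_cast add_right_cancel hC, rfl⟩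

theorem normSq_add_mul_theta (u v : ℝ) : normSq (u + v * theta) = u ^ 2 + u * v + 2 * v ^ 2 := by
  have h7 : Real.sqrt 7 * Real.sqrt 7 = 7 := Real.mul_self_sqrt (by norm_num)
  simp only [normSq_apply, add_re, ofReal_re, mul_re, theta_re, ofReal_im, theta_im, add_im, mul_im,
    zero_mul, sub_zero, zero_add, add_zero]
  linear_combination (v ^ 2 / 4) * h7

/-- Every complex number lies within distance less than `1` of `ℤ[θ]`. -/
theorem exists_normSq_sub_lt_one (z : ℂ) : ∃ q : ZTheta, normSq (z - q) < 1 := by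
  have h7 : Real.sqrt 7 ≠ 0 := by positivity
  obtain ⟨u, v, rfl⟩ : ∃ u v : ℝ, z = u + v * theta := by
    refine ⟨z.re - z.im / Real.sqrt 7, 2 * z.im / Real.sqrt 7, Complex.ext ?_ ?_⟩
    · simp only [add_re, ofReal_re, mul_re, theta_re, ofReal_im]; ring
    · simp only [add_im, ofReal_im, mul_im, theta_im, ofReal_re]; field_simp; ring
  let y : ℤ := round v
  -- From u² + uv + 2v² = (u + v/2)² + 7v²/4, rounding this way bounds the norm by 1/4 + 7/16 < 1.
  let x : ℤ := round (u + (v - y) / 2)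
  refine ⟨(x : ZTheta) + y * th, ?_⟩
  have hy := abs_le.mp (abs_sub_round v)
  have hx := abs_le.mp (abs_sub_round (u + (v - y) / 2))
  have heq : (u + v * theta - (((x : ZTheta) + y * th : ZTheta) : ℂ)) =
      ((u - x : ℝ) : ℂ) + ((v - y : ℝ) : ℂ) * theta := by
    simp [th]; ring
  rw [heq, normSq_add_mul_theta]
  change -(1 / 2) ≤ v - y ∧ v - y ≤ 1 / 2 at hy
  change -(1 / 2) ≤ u + (v - y) / 2 - x ∧ u + (v - y) / 2 - x ≤ 1 / 2 at hx
  have h1 : (v - y) ^ 2 ≤ 1 / 4 := by nlinarith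
  have h2 : (u + (v - y) / 2 - x) ^ 2 ≤ 1 / 4 := by nlinarith
  nlinarith

/-- The norm form of `ℤ[θ]` takes natural number values. -/
theorem exists_normSq_eq_natCast (z : ZTheta) : ∃ n : ℕ, normSq (z : ℂ) = n := by
  obtain ⟨x, y, rfl⟩ := exists_eq_add_mul_th z
  refine ⟨(x ^ 2 + x * y + 2 * y ^ 2).toNat, ?_⟩
  have h0 : 0 ≤ x ^ 2 + x * y + 2 * y ^ 2 := by nlinarith [sq_nonneg (2 * x + y), sq_nonneg y]
  have h := normSq_add_mul_theta x y
  rw [← Int.cast_natCast, Int.toNat_of_nonneg h0]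
  push_cast
  rw [← h]
  simp [th]

instance : IsPrincipalIdealRing ZTheta := by
  classical
  choose N hN using exists_normSq_eq_natCast
  refine ⟨fun I => ?_⟩
  by_cases hI : I = ⊥
  · exact hI ▸ inferInstance
  obtain ⟨a₀, ha₀, ha₀'⟩ := Submodule.exists_mem_ne_zero_of_ne_bot hI
  have hex : ∃ n, ∃ a ∈ I, a ≠ 0 ∧ N a = n := ⟨_, a₀, ha₀, ha₀', rfl⟩
  obtain ⟨a, haI, ha0, hNa⟩ := Nat.find_spec hex
  have haC : (a : ℂ) ≠ 0 := fun h => ha0 (Subtype.ext h)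
  refine ⟨a, le_antisymm (fun b hb => ?_) ((Ideal.span_singleton_le_iff_mem _).mpr haI)⟩
  obtain ⟨q, hq⟩ := exists_normSq_sub_lt_one ((b : ℂ) / a)
  have hlt : N (b - q * a) < N a := by
    have h1 : ((b - q * a : ZTheta) : ℂ) = ((b : ℂ) / a - q) * a := by
      push_cast; field_simp
    have h2 : (N (b - q * a) : ℝ) < N a := by
      rw [← hN, ← hN, h1, map_mul]
      exact mul_lt_of_lt_one_left (normSq_pos.mpr haC) hq
    exact_mod_cast h2
  by_cases h0 : b - q * a = 0
  · exact Ideal.mem_span_singleton'.mpr ⟨q, (sub_eq_zero.mp h0).symm⟩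
  · exact absurd ⟨_, I.sub_mem hb (I.mul_mem_left q haI), h0, rfl⟩ (Nat.find_min hex (hNa ▸ hlt))

/-- θ(p + qθ) = -2q + (p + q)θ. This reduces the primality of θ to that of 2 in ℤ. -/
theorem th_dvd_add_mul_th_iff (x y : ℤ) : th ∣ (x : ZTheta) + y * th ↔ 2 ∣ x := by
  constructor
  · rintro ⟨z, hz⟩
    obtain ⟨p, q, rfl⟩ := exists_eq_add_mul_th z
    have h := add_mul_th_injective (x := x) (y := y) (x' := -2 * q) (y' := p + q) (by
      rw [hz]; push_cast; linear_combination (q : ZTheta) * th_sq)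
    exact ⟨-q, by rw [h.1]; ring⟩
  · rintro ⟨k, rfl⟩
    exact ⟨k * (1 - th) + y, by push_cast; linear_combination (k : ZTheta) * th_sq⟩

theorem th_ne_zero : th ≠ 0 := fun h => by
  have := add_mul_th_injective (x := 0) (y := 1) (x' := 0) (y' := 0) (by simp [h])
  omega

theorem prime_th : Prime th := by
  refine ⟨th_ne_zero, fun h => ?_, fun u v huv => ?_⟩
  · have := (th_dvd_add_mul_th_iff 1 0).mp (h.dvd)
    omega
  · obtain ⟨x, y, rfl⟩ := exists_eq_add_mul_th u
    obtain ⟨x', y', rfl⟩ := exists_eq_add_mul_th v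
    have h : ((x : ZTheta) + y * th) * (x' + y' * th) =
        ((x * x' - 2 * y * y' : ℤ) : ZTheta) + ((x * y' + y * x' + y * y' : ℤ) : ZTheta) * th := by
      push_cast; linear_combination (y * y' : ZTheta) * th_sq
    rw [h, th_dvd_add_mul_th_iff] at huv
    rw [th_dvd_add_mul_th_iff, th_dvd_add_mul_th_iff]
    refine Int.prime_two.dvd_or_dvd ?_
    have : x * x' = (x * x' - 2 * y * y') + 2 * (y * y') := by ring
    rw [this]
    exact dvd_add huv (dvd_mul_right _ _)

instance isMaximal_span_th : (Ideal.span {th}).IsMaximal :=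
  ((Ideal.span_singleton_prime th_ne_zero).mpr prime_th).isMaximal
    (by simpa using th_ne_zero)

theorem two_eq : (2 : ZTheta) = th * (1 - th) := by linear_combination th_sq

theorem span_th_le : Ideal.span {(2 : ZTheta), th} = Ideal.span {th} := by
  refine le_antisymm (Ideal.span_le.mpr ?_) (Ideal.span_mono (by simp))
  rintro _ (rfl | rfl)
  · exact Ideal.mem_span_singleton.mpr ⟨_, two_eq⟩
  · exact Ideal.mem_span_singleton_self _

theorem one_sub_th_notMem : 1 - th ∉ Ideal.span {th} := fun h =>
  Ideal.IsPrime.one_notMem (isMaximal_span_th.isPrime)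
    (by simpa using add_mem h (Ideal.mem_span_singleton_self th))

theorem gam_eq : Gam (1 - th) th (1 - th) = {Ideal.span {th}} := by
  ext P
  simp only [Gam, Set.mem_ofPred_eq, Set.mem_singleton_iff, span_th_le]
  constructor
  · rintro ⟨hP, hle, -⟩
    exact (isMaximal_span_th.eq_of_le hP.ne_top hle).symm
  · rintro rfl
    exact ⟨isMaximal_span_th.isPrime, le_rfl, fun h =>
      one_sub_th_notMem (h (Ideal.subset_span (by simp)))⟩

theorem th_notMem_sq : th ∉ Ideal.span {th} ^ 2 := by
  rw [Ideal.span_singleton_pow, Ideal.mem_span_singleton]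
  intro h
  have := pow_dvd_pow_iff (m := 1) (n := 2) th_ne_zero prime_th.not_isUnit |>.not.mpr (by norm_num)
  exact this (by simpa using h)

theorem regularAt_span_th : RegularAt (Ideal.span {th}) (1 - th) th (1 - th) 1 1 where
  a_notMem := one_sub_th_notMem
  sq_d := Ideal.mem_span_singleton.mpr ⟨1, by ring⟩
  sq_e := Ideal.mem_span_singleton.mpr ⟨1, by ring⟩
  b_sub := by
    rw [Ideal.span_singleton_pow, Ideal.mem_span_singleton]
    exact ⟨1, by linear_combination -th_sq⟩
  cd_sub := by simp
  a_sub h := th_notMem_sq (by simpa using neg_mem h)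

end ConicExample
-- Regularity of the conic
/-- If `f ∈ q` lies in `q ^ 2 A_q`, then all derivatives of `f` lie in `q`. -/
theorem Derivation.apply_mem_of_mul_mem_sq {R A : Type*} [CommRing R] [CommRing A] [Algebra R A]
    (D : Derivation R A A) {q : Ideal A} [q.IsPrime] {s f : A} (hs : s ∉ q) (hf : f ∈ q)
    (hsf : s * f ∈ q ^ 2) : D f ∈ q := by
  have hD : ∀ x ∈ q ^ 2, D x ∈ q := by
    intro x hx
    rw [pow_two] at hx
    refine Submodule.mul_induction_on hx (fun m hm n hn => ?_) (fun x y hx hy => ?_)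
    · rw [D.leibniz]
      exact add_mem (q.mul_mem_right _ hm) (q.mul_mem_right _ hn)
    · rw [map_add]; exact add_mem hx hy
  have h := hD _ hsf
  rw [D.leibniz, smul_eq_mul, smul_eq_mul] at h
  exact ((Ideal.IsPrime.mem_or_mem inferInstance
    ((Ideal.add_mem_iff_left _ (q.mul_mem_right _ hf)).mp h))).resolve_left hs

namespace ConicExample
open MvPolynomial

theorem C_th_sq {σ : Type*} : (C th : MvPolynomial σ ZTheta) ^ 2 = C th - 2 := by
  rw [← map_pow, th_sq, map_sub, map_ofNat]

theorem conicPoly_th : conicPoly (1 - th) th (1 - th) =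
    (1 - C th) * X 0 ^ 2 + C th * X 0 * X 1 + (1 - C th) * X 1 ^ 2 - 1 := by
  simp only [conicPoly, map_sub, map_one]

theorem th_mem_of_mul_mem_sq {q : Ideal (MvPolynomial (Fin 2) ZTheta)} [hq : q.IsPrime]
    {s : MvPolynomial (Fin 2) ZTheta} (hs : s ∉ q) (hf : conicPoly (1 - th) th (1 - th) ∈ q)
    (hsf : s * conicPoly (1 - th) th (1 - th) ∈ q ^ 2) : C th ∈ q := by
  have h0 := (pderiv (R := ZTheta) (0 : Fin 2)).apply_mem_of_mul_mem_sq hs hf hsf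
  have h1 := (pderiv (R := ZTheta) (1 : Fin 2)).apply_mem_of_mul_mem_sq hs hf hsf
  rw [conicPoly] at h0 h1
  simp [pderiv_X, Derivation.leibniz, Derivation.leibniz_pow] at h0 h1
  rw [conicPoly_th] at hf
  -- Euler: X·∂f/∂X + Y·∂f/∂Y - 2f = 2 = θ(1 - θ).
  have h2 : C th * (1 - C th) ∈ q := by
    have := sub_mem (add_mem (q.mul_mem_left (X 0) h0) (q.mul_mem_left (X 1) h1))
      (q.mul_mem_left 2 hf)
    convert! this using 1
    linear_combination -C_th_sq
  by_contra hth
  -- If 1 - θ ∈ q, the partials reduce to θY and θX, so X, Y ∈ q and f ≡ -1.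
  have ha := (hq.mem_or_mem h2).resolve_left hth
  have hY : X 1 ∈ q := by
    refine (hq.mem_or_mem (?_ : C th * X 1 ∈ q)).resolve_left hth
    convert! sub_mem h0 (q.mul_mem_left (2 * X 0) ha) using 1
    ring
  have hX : X 0 ∈ q := by
    refine (hq.mem_or_mem (?_ : C th * X 0 ∈ q)).resolve_left hth
    convert! sub_mem h1 (q.mul_mem_left (2 * X 1) ha) using 1
    ring
  refine hq.one_notMem ?_
  convert! sub_mem (add_mem (q.mul_mem_left ((1 - C th) * X 0 + C th * X 1) hX)
    (q.mul_mem_left ((1 - C th) * X 1) hY)) hf using 1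
  ring

theorem polynomial_mem_of_mul_th_mem_sq {q : Ideal (Polynomial ZTheta)}
    (hth : Polynomial.C th ∈ q) {s : Polynomial ZTheta}
    (hs : s * Polynomial.C th ∈ q ^ 2) : s ∈ q := by
  let _ : Field (ZTheta ⧸ Ideal.span {th}) := Ideal.Quotient.field _
  obtain ⟨h, rfl⟩ := Ideal.exists_eq_span_pair
    (Polynomial.mapRingHom (Ideal.Quotient.mk (Ideal.span {th})))
    (Polynomial.map_surjective _ Ideal.Quotient.mk_surjective) (t := Polynomial.C th)
    (by rw [Polynomial.ker_mapRingHom, Ideal.mk_ker, Ideal.map_span, Set.image_singleton]) hth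
  exact Ideal.mem_of_mul_mem_span_pair_sq (Polynomial.prime_C_iff.mpr prime_th) hs

/-- Over `(θ, X + Y + 1)`, reduction to one variable shows that `θ ∉ q ^ 2 A_q`. -/
theorem mem_of_mul_th_mem_sq {q : Ideal (MvPolynomial (Fin 2) ZTheta)}
    (hth : C th ∈ q) (hw : X 0 + X 1 + 1 ∈ q) {s : MvPolynomial (Fin 2) ZTheta}
    (hs : s * C th ∈ q ^ 2) : s ∈ q := by
  -- Eliminate Y by w = 0: since w ∈ q, membership in q can be tested after `φ`, in one variable.
  let φ : MvPolynomial (Fin 2) ZTheta →ₐ[ZTheta] Polynomial ZTheta :=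
    aeval ![Polynomial.X, -1 - Polynomial.X]
  let ι : Polynomial ZTheta →ₐ[ZTheta] MvPolynomial (Fin 2) ZTheta := Polynomial.aeval (X 0)
  have hcomp : ((Ideal.Quotient.mkₐ ZTheta q).comp ι).comp φ = Ideal.Quotient.mkₐ ZTheta q := by
    refine MvPolynomial.algHom_ext fun i => ?_
    fin_cases i
    · simp [φ, ι]
    · simp only [φ, ι, AlgHom.comp_apply, aeval_X, Ideal.Quotient.mkₐ_eq_mk]
      refine Ideal.Quotient.eq.mpr ?_
      convert! neg_mem hw using 1
      simp
      ring
  have hmem : ∀ p, φ p ∈ q.comap ι ↔ p ∈ q := fun p => by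
    rw [Ideal.mem_comap, ← Ideal.Quotient.eq_zero_iff_mem, ← Ideal.Quotient.eq_zero_iff_mem]
    exact Eq.congr_left (DFunLike.congr_fun hcomp p)
  have hφC : φ (C th) = Polynomial.C th := by simp [φ]
  refine (hmem s).mp (polynomial_mem_of_mul_th_mem_sq ?_ ?_)
  · rw [← hφC, hmem]; exact hth
  · rw [← hφC, ← map_mul]
    have h1 : q.map φ ≤ q.comap ι := Ideal.map_le_iff_le_comap.mpr fun p hp => (hmem p).mpr hp
    have h2 := Ideal.mem_map_of_mem φ hs
    rw [Ideal.map_pow] at h2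
    exact Ideal.pow_right_mono h1 2 h2

theorem isRegularRing_conicRing : IsRegularRing (ConicRing (1 - th) th (1 - th)) := by
  refine IsRegularRing.quotient_span_singleton _ fun q hq hf s hsf => ?_
  by_contra hs
  have hth := th_mem_of_mul_mem_sq hs hf hsf
  rw [conicPoly_th] at hf hsf
  have hw : X 0 + X 1 + 1 ∈ q := by
    refine hq.mem_of_pow_mem 2 ?_
    convert! sub_mem hf (q.mul_mem_right (X 0 * X 1 - X 0 ^ 2 - X 1 ^ 2
      - (1 - C th) * (1 + X 0 * X 1 + X 0 + X 1)) hth) using 1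
    linear_combination (1 + X 0 * X 1 + X 0 + X 1) * C_th_sq
  -- The factor next to `s` is g, and θg = f - w².
  have hsg : s * (X 0 * X 1 - X 0 ^ 2 - X 1 ^ 2
      - (1 - C th) * (1 + X 0 * X 1 + X 0 + X 1)) ∈ q := by
    refine mem_of_mul_th_mem_sq hth hw ?_
    convert! sub_mem hsf ((q ^ 2).mul_mem_left s (Ideal.pow_mem_pow hw 2)) using 1
    linear_combination (s * (1 + X 0 * X 1 + X 0 + X 1)) * C_th_sq
  have hg := (hq.mem_or_mem hsg).resolve_left hs
  refine hq.one_notMem ?_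
  convert! sub_mem (add_mem (q.mul_mem_right (-X 0 - X 1) hw) (q.mul_mem_right
    ((1 - C th) * X 0 * X 1 + (1 + X 0 * X 1 + X 0 + X 1)) hth)) hg using 1
  linear_combination (X 0 * X 1) * C_th_sq

/-! ### Failure of smoothness -/

/-- The point `(1, 0)` of the conic over `T ⧸ (θ)` does not lift to `T`. -/
theorem not_smooth_conicRing_of_algebra {T : Type*} [CommRing T] [Algebra ZTheta T]
    (ht0 : algebraMap ZTheta T th ≠ 0) (ht2 : algebraMap ZTheta T th ^ 2 = 0) :
    ¬ Algebra.Smooth ZTheta (ConicRing (1 - th) th (1 - th)) := by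
  intro hsm
  have h2 : (2 : T) = algebraMap ZTheta T th := by
    have := congrArg (algebraMap ZTheta T) th_sq
    rw [map_pow, map_sub, map_ofNat] at this
    linear_combination this - ht2
  have hψC : ∀ ψ : MvPolynomial (Fin 2) ZTheta →ₐ[ZTheta] T, ψ (C th) = algebraMap ZTheta T th :=
    fun ψ => ψ.commutes th
  have hmk : algebraMap ZTheta (T ⧸ Ideal.span {algebraMap ZTheta T th}) th = 0 :=
    Ideal.Quotient.eq_zero_iff_mem.mpr (Ideal.mem_span_singleton_self _)
  generalize algebraMap ZTheta T th = t at *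
  let J : Ideal T := Ideal.span {t}
  have hJ : IsNilpotent J := ⟨2, by
    rw [Ideal.span_singleton_pow, ht2, Ideal.span_singleton_eq_bot.mpr rfl]; rfl⟩
  change algebraMap ZTheta (T ⧸ J) th = 0 at hmk
  let ev : MvPolynomial (Fin 2) ZTheta →ₐ[ZTheta] T ⧸ J := aeval ![1, 0]
  have hev : ∀ p ∈ Ideal.span {conicPoly (1 - th) th (1 - th)}, ev p = 0 := by
    intro p hp
    refine (Ideal.span_singleton_le_iff_mem (RingHom.ker ev)).mpr ?_ hp
    rw [RingHom.mem_ker, conicPoly_th]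
    simp [ev, hmk]
  obtain ⟨σ, hσ⟩ := Algebra.FormallySmooth.exists_lift (R := ZTheta)
    (A := ConicRing (1 - th) th (1 - th)) J hJ (Ideal.Quotient.liftₐ _ ev hev)
  let x : T := σ (Ideal.Quotient.mk _ (X 0))
  let y : T := σ (Ideal.Quotient.mk _ (X 1))
  have hx : x - 1 ∈ J := by
    refine Ideal.Quotient.eq.mp ?_
    have := DFunLike.congr_fun hσ (Ideal.Quotient.mk _ (X 0))
    refine Eq.trans this ?_
    change ev (X 0) = _
    simp [ev]
  have hy : y ∈ J := by
    refine Ideal.Quotient.eq_zero_iff_mem.mp ?_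
    have := DFunLike.congr_fun hσ (Ideal.Quotient.mk _ (X 1))
    refine Eq.trans this ?_
    change ev (X 1) = _
    simp [ev]
  obtain ⟨u, hu⟩ := Ideal.mem_span_singleton.mp hx
  obtain ⟨v, hv⟩ := Ideal.mem_span_singleton.mp hy
  have hrel : (1 - t) * x ^ 2 + t * x * y + (1 - t) * y ^ 2 - 1 = 0 := by
    let ψ : MvPolynomial (Fin 2) ZTheta →ₐ[ZTheta] T :=
      σ.comp (Ideal.Quotient.mkₐ ZTheta (Ideal.span {conicPoly (1 - th) th (1 - th)}))
    have hψ : ψ (conicPoly (1 - th) th (1 - th)) = 0 := by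
      change σ (Ideal.Quotient.mk _ _) = 0
      rw [Ideal.Quotient.eq_zero_iff_mem.mpr (Ideal.mem_span_singleton_self _), map_zero]
    rw [conicPoly_th] at hψ
    simp only [map_sub, map_add, map_mul, map_pow, map_one, hψC ψ] at hψ
    exact hψ
  refine ht0 ?_
  have hx' : x = 1 + t * u := by linear_combination hu
  rw [hx', hv] at hrel
  -- With θ² = 0 and 2 = θ in `T`, also 2θ = 0, so at (1 + θu, θv) the equation collapses to -θ = 0.
  linear_combination -hrel + ((1 - t) * u ^ 2 - 2 * u + v + t * u * v + (1 - t) * v ^ 2) * ht2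
    + (t * u) * h2 + u * ht2

theorem not_smooth_conicRing : ¬ Algebra.Smooth ZTheta (ConicRing (1 - th) th (1 - th)) := by
  refine not_smooth_conicRing_of_algebra (T := ZTheta ⧸ Ideal.span {th} ^ 2) (fun h => ?_) ?_
  · exact th_notMem_sq (Ideal.Quotient.eq_zero_iff_mem.mp h)
  · rw [← map_pow]
    exact Ideal.Quotient.eq_zero_iff_mem.mpr
      (Ideal.pow_mem_pow (Ideal.mem_span_singleton_self th) 2)

end ConicExample

theorem mainTheorem7 :
    IsRegularRing
        (ConicExample.ConicRing (1 - ConicExample.th) ConicExample.th (1 - ConicExample.th)) ∧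
      ¬ Algebra.Smooth ConicExample.ZTheta
        (ConicExample.ConicRing (1 - ConicExample.th) ConicExample.th (1 - ConicExample.th)) ∧
      ConicExample.Gam (1 - ConicExample.th) ConicExample.th (1 - ConicExample.th)
        = {Ideal.span {ConicExample.th}} ∧
      ConicExample.RegularAt (Ideal.span {ConicExample.th})
        (1 - ConicExample.th) ConicExample.th (1 - ConicExample.th) 1 1 :=
  ⟨ConicExample.isRegularRing_conicRing, ConicExample.not_smooth_conicRing, ConicExample.gam_eq,
    ConicExample.regularAt_span_th⟩
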